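/- Let $d\in\mathbb N$ and let $\zeta:\mathbb R^d\to\mathbb R$ be continuous; for continuous $g:\mathbb R^d\to\mathbb R$ put $\|g\|=\sup_{x\in[0,1]^d}|g(x)|$. Let $\epsilon>0$, $q\in[1,\infty)$ and $p\in[0,1)$. A ReLU neural network with $L\ge 1$ layers and widths $d_0=d,d_1,\dots,d_{L-1},d_L=1$ is the function $\Psi:\mathbb R^d\times\mathbb R^n\to\mathbb R$ given by $$\Psi(\cdot,w)=\Psi_L\circ\cdots\circ\Psi_1,\qquad \Psi_j(y)=\sigma_j\bigl(W^{(j)}y+b^{(j)}\bigr),$$ where $w=(W^{(j)},b^{(j)})_{j=1}^L\in\mathbb R^n$ collects the weight matrices $W^{(j)}\in\mathbb R^{d_j\times d_{j-1}}$ and the biases $b^{(j)}\in\mathbb R^{d_j}$, the activation functions act entrywise, $\sigma_j(t)=\max(t,0)$ for $j<L$, and $\sigma_L$ is the identity. A vector of dropconnect filters for $\Psi$ with dropout probability $p$ is a $\{0,1\}^n$-valued random vector $f$ on a probability space whose components that multiply entries of the weight matrices are mutually independent and equal to $1$ with probability $1-p$, and whose components that multiply biases equal $1$ almost surely. Write $\odot$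 for the entrywise product. Then there exist a ReLU neural network $\Psi$ and a parameter vector $w\in\mathbb R^n$ such that dropconnect filters $f$ for $\Psi$ with dropout probability $p$ exist, and every such $f$ (on any probability space) satisfies $$\mathbb P\bigl[\|\Psi(\cdot,w\odot f)-\zeta\|>\epsilon\bigr]<\epsilon,\qquad \mathbb E\bigl[\|\Psi(\cdot,w\odot f)-\zeta\|^q\bigr]^{1/q}<\epsilon,\qquad \|\Psi(\cdot,w\odot\mathbb E[f])-\zeta\|<\epsilon,$$ where the expectation in the second inequality is that of an integrable random variable. -/

import Mathlib

open MeasureTheory ProbabilityTheory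

/-- The layout of a feedforward network from `ℝ^d` to `ℝ`: the number `L ≥ 1` of layers and the
widths `d_0 = d, d_1, …, d_L = 1` (the values `width j` with `j > L` play no role). -/
structure NetLayout (d : ℕ) where
  depth : ℕ
  depth_pos : 0 < depth
  width : ℕ → ℕ
  width_zero : width 0 = d
  width_depth : width depth = 1

namespace NetLayout

variable {d : ℕ} (N : NetLayout d)

/-- Positions of the entries of the weight matrices: a layer `j`, a row and a column. Layer `j`
(counted from `0`) maps `ℝ^(d_j)` to `ℝ^(d_(j+1))`. -/
abbrev WeightIndex : Type :=
  Σ j : Fin N.depth, Fin (N.width (j + 1)) × Fin (N.width j)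

/-- Positions of the entries of the bias vectors. -/
abbrev BiasIndex : Type :=
  Σ j : Fin N.depth, Fin (N.width (j + 1))

/-- The parameter space `ℝ^n`: all entries of all weight matrices and bias vectors. The pointwise
product of functions is the entrywise product of parameter vectors. -/
abbrev Params : Type := N.WeightIndex ⊕ N.BiasIndex → ℝ

/-- The weight matrix of layer `j`. -/
def weight (w : N.Params) (j : Fin N.depth) :
    Matrix (Fin (N.width (j + 1))) (Fin (N.width j)) ℝ :=
  fun r c => w (Sum.inl ⟨j, r, c⟩)

/-- The bias vector of layer `j`. -/
def bias (w : N.Params) (j : Fin N.depth) : Fin (N.width (j + 1)) → ℝ :=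
  fun r => w (Sum.inr ⟨j, r⟩)

/-- The activation functions of a ReLU network: `t ↦ max t 0` in the hidden layers, the identity
in the output layer. -/
noncomputable def reluActivation (j : Fin N.depth) (t : ℝ) : ℝ :=
  if (j : ℕ) + 1 = N.depth then t else max t 0

/-- Layer `j`: the map `y ↦ σ_j (W y + b)`, with `σ_j` applied entrywise. -/
noncomputable def layer (w : N.Params) (j : Fin N.depth) (y : Fin (N.width j) → ℝ) :
    Fin (N.width (j + 1)) → ℝ :=
  fun r => N.reluActivation j ((N.weight w j).mulVec y r + N.bias w j r)

/-- The output of the first `j` layers on the input `x`. -/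
noncomputable def partialEval (w : N.Params) (x : Fin d → ℝ) :
    (j : ℕ) → j ≤ N.depth → Fin (N.width j) → ℝ
  | 0, _ => fun i => x (Fin.cast N.width_zero i)
  | j + 1, h => N.layer w ⟨j, h⟩ (partialEval w x j (Nat.le_of_succ_le h))

/-- The output of the whole network, the only entry of a vector in `ℝ^(d_L) = ℝ^1`. -/
noncomputable def eval (w : N.Params) (x : Fin d → ℝ) : ℝ :=
  N.partialEval w x N.depth le_rfl (Fin.cast N.width_depth.symm 0)

theorem continuous_reluActivation (j : Fin N.depth) : Continuous (N.reluActivation j) := by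
  unfold reluActivation
  split_ifs <;> fun_prop

theorem continuous_layer (w : N.Params) (j : Fin N.depth) : Continuous (N.layer w j) := by
  refine continuous_pi fun r => (N.continuous_reluActivation j).comp ?_
  simp only [Matrix.mulVec, dotProduct]
  fun_prop

theorem continuous_partialEval (w : N.Params) :
    ∀ (j : ℕ) (h : j ≤ N.depth), Continuous fun x => N.partialEval w x j h
  | 0, _ => by
    simp only [partialEval]
    fun_prop
  | j + 1, h => by
    simp only [partialEval]
    exact (N.continuous_layer w _).comp (continuous_partialEval w j _)

theorem continuous_eval (w : N.Params) : Continuous (N.eval w) :=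
  (continuous_apply _).comp (N.continuous_partialEval w N.depth le_rfl)

/-- The function `Ψ(·, w)` computed by the network, an element of the space of continuous
functions. -/
noncomputable def reluNet (w : N.Params) : C(Fin d → ℝ, ℝ) := ⟨N.eval w, N.continuous_eval w⟩

/-- `f` is a vector of dropconnect filter variables with dropout probability `p` on the probability
space `(Ω, P)`: a `{0,1}`-valued random vector whose components that multiply the entries of the
weight matrices are mutually independent and equal to `1` with probability `1 - p`, while the
components that multiply biases are almost surely equal to `1`. -/
structure IsDropconnectFilter {Ω : Type*} [MeasurableSpace Ω] (P : Measure Ω) (p : ℝ)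
    (f : Ω → N.Params) : Prop where
  measurable : Measurable f
  zero_or_one : ∀ ω i, f ω i = 0 ∨ f ω i = 1
  weight_prob : ∀ e : N.WeightIndex, P {ω | f ω (Sum.inl e) = 1} = ENNReal.ofReal (1 - p)
  weight_indep : iIndepFun (fun (e : N.WeightIndex) (ω : Ω) => f ω (Sum.inl e)) P
  bias_one : ∀ b : N.BiasIndex, ∀ᵐ ω ∂P, f ω (Sum.inr b) = 1

/-- The entrywise expectation `E[f]` of a random parameter vector. -/
noncomputable def expectedFilter {Ω : Type*} [MeasurableSpace Ω] (P : Measure Ω)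
    (f : Ω → N.Params) : N.Params :=
  fun i => ∫ ω, f ω i ∂P

end NetLayout

/-- The seminorm `sup_{x ∈ [0,1]^d} |g x|` on continuous functions (the supremum is over a
non-empty compact set). -/
noncomputable def cubeSup {d : ℕ} (g : C(Fin d → ℝ, ℝ)) : ℝ :=
  ⨆ x : Set.Icc (0 : Fin d → ℝ) 1, |g x|

/-!
A network with one hidden layer, `x ↦ ∑ i, c i * max (a i · x + b i) 0`, approximates `ζ` on the
cube (`exists_shallow_near`). It is made robust against dropconnect by replication, which gives a
network with two hidden layers. The first one has `n` copies of every input: since inputs in the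
cube are nonnegative, the copy `k` of `x j` is a ReLU unit that computes `φ * x j` with `φ` the
filter variable of its only edge of nonzero weight. The second one has `n` copies of every unit `i`
of the shallow network. With `π = 1 - p`, the weights into it are `a i j / (n * π ^ 2)`, those into
the output are `c i / (n * π)`; see `replicaLayout.eval_params_mul`.

The filtered network is a shallow network whose coefficients are multiplied by averages of `n`
pairwise independent `{0,1}`-valued variables, divided by their common mean. Two edges in a row
contribute the products of their two filter variables, and products that belong to different copies
share no variable. By the weak law of large numbers (`integral_abs_mean_div_sub_one_le`) the mean
deviation of these averages from `1` is of order `1 / √n`, and it bounds the distance to the shallow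
network uniformly in `x` (`abs_replicated_sub_shallow_le`). The deviations are also bounded
independently of `n`, so a small mean gives smallness in probability and in every `L^q`
(`error_small`). Under the expected filter all averages are exactly `1`, so that the network
computes the shallow network itself.
-/

/-! ### Univariate approximation by ReLU units -/

/-- The space of functions `ℝ → ℝ` computed by networks with one hidden layer of ReLU units. -/
def reluSpan : Submodule ℝ (ℝ → ℝ) :=
  Submodule.span ℝ {g | ∃ s b : ℝ, g = fun t => max (s * t + b) 0}

theorem unit_mem_reluSpan (s b : ℝ) : (fun t : ℝ => max (s * t + b) 0) ∈ reluSpan :=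
  Submodule.subset_span ⟨s, b, rfl⟩

theorem const_mem_reluSpan (c : ℝ) : (fun _ : ℝ => c) ∈ reluSpan := by
  have h := reluSpan.smul_mem c (unit_mem_reluSpan 0 1)
  convert! h using 1
  ext t
  simp

/-- A ramp of width `h` that rises from `0` at `u` to `1` at `u + h` is a difference of two ReLU
units. -/
theorem exists_ramp_mem_reluSpan (u : ℝ) {h : ℝ} (hh : 0 < h) :
    ∃ r ∈ reluSpan, (∀ t ≤ u, r t = 0) ∧ (∀ t, u + h ≤ t → r t = 1) ∧
      ∀ t, 0 ≤ r t ∧ r t ≤ 1 := by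
  have key : ∀ t, (t - u) / h = 1 / h * t + -u / h := fun t => by ring
  refine ⟨_, reluSpan.sub_mem (unit_mem_reluSpan (1 / h) (-u / h))
    (unit_mem_reluSpan (1 / h) (-u / h - 1)), fun t ht => ?_, fun t ht => ?_, fun t => ?_⟩
  · have h0 : (t - u) / h ≤ 0 := div_nonpos_of_nonpos_of_nonneg (by linarith) hh.le
    rw [key] at h0
    simp only [Pi.sub_apply]
    rw [max_eq_right h0, max_eq_right (by linarith), sub_zero]
  · have h0 : 1 ≤ (t - u) / h := (one_le_div hh).2 (by linarith)
    rw [key] at h0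
    simp only [Pi.sub_apply]
    rw [max_eq_left (by linarith), max_eq_left (by linarith)]
    ring
  · simp only [Pi.sub_apply]
    constructor <;>
    rcases max_cases (1 / h * t + -u / h) 0 with h1 | h1 <;>
    rcases max_cases (1 / h * t + (-u / h - 1)) 0 with h2 | h2 <;> linarith

/-- Univariate approximation: the piecewise linear interpolant of `f` is built from left to right,
adding one ramp per node and staying constant to the right of the last node. -/
theorem exists_mem_reluSpan_near {f : ℝ → ℝ} (hf : Continuous f) (a b : ℝ) {η : ℝ} (hη : 0 < η) :
    ∃ g ∈ reluSpan, ∀ t ∈ Set.Icc a b, |g t - f t| ≤ η := by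
  have huc := (isCompact_Icc (a := a) (b := b + 1)).uniformContinuousOn_of_continuous
    hf.continuousOn
  obtain ⟨δ₀, hδ₀, hδ₀f⟩ := Metric.uniformContinuousOn_iff_le.1 huc (η / 2) (by positivity)
  obtain ⟨δ, hδ, hδ1, hδf⟩ : ∃ δ > 0, δ ≤ 1 ∧ ∀ x ∈ Set.Icc a (b + 1), ∀ y ∈ Set.Icc a (b + 1),
      |x - y| ≤ δ → |f x - f y| ≤ η / 2 :=
    ⟨min δ₀ 1, by positivity, min_le_right _ _, fun x hx y hy hxy =>
      hδ₀f x hx y hy (hxy.trans (min_le_left _ _))⟩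
  have step : ∀ m : ℕ, a + m * δ ≤ b + 1 → ∃ g ∈ reluSpan,
      (∀ t, a + m * δ ≤ t → g t = f (a + m * δ)) ∧
      ∀ t ∈ Set.Icc a (a + m * δ), |g t - f t| ≤ η := by
    intro m
    induction m with
    | zero =>
      refine fun _ => ⟨_, const_mem_reluSpan (f a), by simp, fun t ht => ?_⟩
      obtain rfl : t = a := le_antisymm (by simpa using ht.2) ht.1
      simpa using hη.le
    | succ m ih =>
      intro hm
      push_cast at hm ⊢
      obtain ⟨g, hg, hg1, hg2⟩ := ih (by linarith)
      obtain ⟨r, hr, hr0, hr1, hr01⟩ := exists_ramp_mem_reluSpan (a + m * δ) hδ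
      have hmδ : 0 ≤ m * δ := by positivity
      have hΔ := hδf (a + (m + 1) * δ) ⟨by linarith, by linarith⟩ (a + m * δ)
        ⟨by linarith, by linarith⟩ (by
          rw [show a + (m + 1) * δ - (a + m * δ) = δ by ring, abs_of_pos hδ])
      refine ⟨g + (f (a + (m + 1) * δ) - f (a + m * δ)) • r,
        reluSpan.add_mem hg (reluSpan.smul_mem _ hr), fun t ht => ?_, fun t ht => ?_⟩
      · simp only [Pi.add_apply, Pi.smul_apply, smul_eq_mul]
        rw [hg1 t (by linarith), hr1 t (by linarith)]
        ring
      · simp only [Pi.add_apply, Pi.smul_apply, smul_eq_mul]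
        rcases le_total t (a + m * δ) with h | h
        · rw [hr0 t h, mul_zero, add_zero]
          exact hg2 t ⟨ht.1, h⟩
        · rw [hg1 t h]
          have h3 := hδf (a + m * δ) ⟨by linarith, by linarith⟩ t
            ⟨ht.1, ht.2.trans hm⟩ (by
              rw [abs_sub_comm, abs_of_nonneg (by linarith)]
              linarith [ht.2])
          have h4 : |(f (a + (m + 1) * δ) - f (a + m * δ)) * r t| ≤ η / 2 := by
            rw [abs_mul, abs_of_nonneg (hr01 t).1]
            exact (mul_le_of_le_one_right (abs_nonneg _) (hr01 t).2).trans hΔ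
          calc _ = |(f (a + m * δ) - f t) + (f (a + (m + 1) * δ) - f (a + m * δ)) * r t| := by
                congr 1; ring
            _ ≤ η := (abs_add_le _ _).trans (by linarith)
  rcases lt_or_ge b a with hab | hab
  · exact ⟨0, reluSpan.zero_mem, fun t ht => absurd (ht.1.trans ht.2) (not_le.2 hab)⟩
  have hN := Nat.le_ceil ((b - a) / δ)
  have hN' := Nat.ceil_lt_add_one (div_nonneg (sub_nonneg.2 hab) hδ.le)
  rw [div_le_iff₀ hδ] at hN
  have hN'' : (⌈(b - a) / δ⌉₊ : ℝ) * δ < b - a + δ := by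
    calc _ < ((b - a) / δ + 1) * δ := by gcongr
      _ = _ := by field_simp
  obtain ⟨g, hg, -, hg2⟩ := step ⌈(b - a) / δ⌉₊ (by linarith)
  exact ⟨g, hg, fun t ht => hg2 t ⟨ht.1, by linarith [ht.2]⟩⟩

/-! ### Approximation on the cube by one hidden layer -/

/-- The cube `[0,1]^d`. -/
abbrev Cube (d : ℕ) : Type := Set.Icc (0 : Fin d → ℝ) 1

/-- The linear functional with coefficients `a`, restricted to the cube. -/
def cubeLinear {d : ℕ} (a : Fin d → ℝ) : C(Cube d, ℝ) where
  toFun x := ∑ j, a j * x.1 j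
  continuous_toFun :=
    (show Continuous fun y : Fin d → ℝ => ∑ j, a j * y j by fun_prop).comp continuous_subtype_val

/-- The continuous function on the cube computed by the ReLU unit with weights `a` and bias `b`. -/
def cubeUnit {d : ℕ} (a : Fin d → ℝ) (b : ℝ) : C(Cube d, ℝ) where
  toFun x := max (cubeLinear a x + b) 0

/-- The space of functions on the cube computed by networks with one hidden layer of ReLU units. -/
def cubeReluSpan (d : ℕ) : Submodule ℝ C(Cube d, ℝ) :=
  Submodule.span ℝ {g | ∃ (a : Fin d → ℝ) (b : ℝ), g = cubeUnit a b}

/-- Composing a univariate network with a linear functional gives a network with the same hidden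
units. -/
theorem exists_cubeReluSpan_comp {d : ℕ} (a : Fin d → ℝ) {g : ℝ → ℝ} (hg : g ∈ reluSpan) :
    ∃ G ∈ cubeReluSpan d, ∀ x, G x = g (cubeLinear a x) := by
  induction hg using Submodule.span_induction with
  | mem g hg =>
    obtain ⟨s, b, rfl⟩ := hg
    refine ⟨_, Submodule.subset_span ⟨s • a, b, rfl⟩, fun x => ?_⟩
    simp [cubeUnit, cubeLinear, Finset.mul_sum, mul_assoc]
  | zero => exact ⟨0, Submodule.zero_mem _, by simp⟩
  | add g h _ _ ihg ihh =>
    obtain ⟨G, hG, hG'⟩ := ihg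
    obtain ⟨H, hH, hH'⟩ := ihh
    exact ⟨G + H, Submodule.add_mem _ hG hH, by simp [hG', hH']⟩
  | smul c g _ ih =>
    obtain ⟨G, hG, hG'⟩ := ih
    exact ⟨c • G, Submodule.smul_mem _ c hG, by simp [hG']⟩

/-- The multiplicative monoid of the functions `x ↦ exp (a · x)` on the cube. -/
noncomputable def cubeExp (d : ℕ) : Submonoid C(Cube d, ℝ) where
  carrier := {g | ∃ a : Fin d → ℝ, ∀ x, g x = Real.exp (cubeLinear a x)}
  one_mem' := ⟨0, by simp [cubeLinear]⟩
  mul_mem' := by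
    rintro g h ⟨a, ha⟩ ⟨b, hb⟩
    exact ⟨a + b, fun x => by
      simp [ha, hb, cubeLinear, add_mul, Finset.sum_add_distrib, Real.exp_add]⟩

/-- Universal approximation by one hidden layer. The exponentials of linear functionals span an
algebra that separates points, and each of them is a limit of univariate networks applied to a
linear functional. -/
theorem cubeReluSpan_topologicalClosure (d : ℕ) : (cubeReluSpan d).topologicalClosure = ⊤ := by
  have hexp : (cubeExp d : Set C(Cube d, ℝ)) ⊆ (cubeReluSpan d).topologicalClosure := by
    rintro F ⟨a, hF⟩
    refine Metric.mem_closure_iff.2 fun η hη => ?_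
    obtain ⟨M, hM⟩ := (isCompact_range (cubeLinear a).continuous).isBounded.subset_closedBall 0
    obtain ⟨g, hg, hgf⟩ := exists_mem_reluSpan_near Real.continuous_exp (-M) M (half_pos hη)
    obtain ⟨G, hG, hG'⟩ := exists_cubeReluSpan_comp a hg
    refine ⟨G, hG, lt_of_le_of_lt ?_ (half_lt_self hη)⟩
    refine (ContinuousMap.dist_le (half_pos hη).le).2 fun x => ?_
    rw [hF, hG', dist_comm, Real.dist_eq]
    have := hM ⟨x, rfl⟩
    rw [mem_closedBall_zero_iff, Real.norm_eq_abs, abs_le] at this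
    exact hgf _ this
  have hsep : (Algebra.adjoin ℝ (cubeExp d : Set C(Cube d, ℝ))).SeparatesPoints := by
    intro x y hxy
    obtain ⟨j, hj⟩ : ∃ j, x.1 j ≠ y.1 j := by
      by_contra! h
      exact hxy (Subtype.ext (funext h))
    refine ⟨_, ⟨⟨fun z => Real.exp (cubeLinear (Pi.single j 1) z), by fun_prop⟩,
      Algebra.subset_adjoin ⟨Pi.single j 1, fun z => rfl⟩, rfl⟩, ?_⟩
    simpa [cubeLinear, Pi.single_apply] using hj
  have htop := ContinuousMap.subalgebra_topologicalClosure_eq_top_of_separatesPoints _ hsep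
  have hle : Subalgebra.toSubmodule (Algebra.adjoin ℝ (cubeExp d : Set C(Cube d, ℝ))) ≤
      (cubeReluSpan d).topologicalClosure := by
    rw [Algebra.adjoin_eq_span, Submonoid.closure_eq]
    exact Submodule.span_le.2 hexp
  refine top_unique fun F _ => ?_
  have hF : F ∈ (Algebra.adjoin ℝ (cubeExp d : Set C(Cube d, ℝ))).topologicalClosure := by
    rw [htop]; trivial
  exact closure_minimal hle (Submodule.isClosed_topologicalClosure _) hF

/-- Universal approximation by one hidden layer, with the network written out. -/
theorem exists_shallow_near {d : ℕ} (ζ : C(Fin d → ℝ, ℝ)) {η : ℝ} (hη : 0 < η) :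
    ∃ (I : ℕ) (c : Fin I → ℝ) (a : Fin I → Fin d → ℝ) (b : Fin I → ℝ), ∀ x : Cube d,
      |∑ i, c i * max (∑ j, a i j * x.1 j + b i) 0 - ζ x.1| ≤ η := by
  have h : ζ.restrict (Set.Icc 0 1) ∈ (cubeReluSpan d).topologicalClosure := by
    rw [cubeReluSpan_topologicalClosure]; trivial
  obtain ⟨G, hG, hGζ⟩ := Metric.mem_closure_iff.1 h η hη
  obtain ⟨I, c, g, rfl⟩ := Submodule.mem_span_set'.1 hG
  choose a b hab using fun i => (g i).2
  refine ⟨I, c, a, b, fun x => ?_⟩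
  have := (ContinuousMap.dist_apply_le_dist x).trans hGζ.le
  rw [dist_comm, Real.dist_eq] at this
  simpa [hab, cubeUnit, cubeLinear] using this

/-! ### The replicated network -/

/-- The widths `d, d * n, I * n, 1` of a network with two hidden layers. -/
def replicaWidth (d n I : ℕ) : ℕ → ℕ
  | 0 => d
  | 1 => d * n
  | 2 => I * n
  | _ => 1

/-- The layout of the replicated network: a first hidden layer with `n` copies of each of the `d`
inputs, and a second hidden layer with `n` copies of each of `I` ReLU units. -/
def replicaLayout (d n I : ℕ) : NetLayout d where
  depth := 3
  depth_pos := by norm_num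
  width := replicaWidth d n I
  width_zero := rfl
  width_depth := rfl

namespace replicaLayout

variable {d n I : ℕ}

/-- The edge from the input `j` to its copy `k`. -/
def inputEdge (j : Fin d) (k : Fin n) : (replicaLayout d n I).WeightIndex :=
  ⟨(0 : Fin 3), (finProdFinEquiv (m := d) (n := n) (j, k), j)⟩

/-- The edge from the copy `k` of the input `j` to the copy `m` of the unit `i`. -/
def hiddenEdge (i : Fin I) (m : Fin n) (j : Fin d) (k : Fin n) :
    (replicaLayout d n I).WeightIndex :=
  ⟨(1 : Fin 3), (finProdFinEquiv (m := I) (n := n) (i, m),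
    finProdFinEquiv (m := d) (n := n) (j, k))⟩

/-- The edge from the copy `m` of the unit `i` to the output. -/
def outputEdge (i : Fin I) (m : Fin n) : (replicaLayout d n I).WeightIndex :=
  ⟨(2 : Fin 3), ((0 : Fin 1), finProdFinEquiv (m := I) (n := n) (i, m))⟩

theorem inputEdge_ne {j j' : Fin d} {k k' : Fin n} (h : k ≠ k') :
    (inputEdge j k : (replicaLayout d n I).WeightIndex) ≠ inputEdge j' k' := by
  intro h'
  have := (Prod.ext_iff.1 (eq_of_heq (Sigma.mk.inj h').2)).1
  exact h (congrArg Prod.snd ((finProdFinEquiv (m := d) (n := n)).injective this))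

theorem hiddenEdge_ne {i i' : Fin I} {m m' : Fin n} {j j' : Fin d} {k k' : Fin n} (h : k ≠ k') :
    hiddenEdge i m j k ≠ hiddenEdge i' m' j' k' := by
  intro h'
  have := (Prod.ext_iff.1 (eq_of_heq (Sigma.mk.inj h').2)).2
  exact h (congrArg Prod.snd ((finProdFinEquiv (m := d) (n := n)).injective this))

theorem outputEdge_ne {i i' : Fin I} {m m' : Fin n} (h : m ≠ m') :
    (outputEdge i m : (replicaLayout d n I).WeightIndex) ≠ outputEdge i' m' := by
  intro h'
  have := (Prod.ext_iff.1 (eq_of_heq (Sigma.mk.inj h').2)).2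
  exact h (congrArg Prod.snd ((finProdFinEquiv (m := I) (n := n)).injective this))

theorem hiddenEdge_ne_inputEdge (i : Fin I) (m : Fin n) (j j' : Fin d) (k k' : Fin n) :
    hiddenEdge i m j k ≠ inputEdge j' k' := by
  intro h
  exact absurd (congrArg (fun e => (e.1 : ℕ)) h) (by simp [hiddenEdge, inputEdge])

/-- The parameters of the replicated network. Every copy of an input receives it with weight `1`.
The weights `a` and `c` of the shallow network are divided by the number of copies they are summed
over, and by the mean `π ^ 2` or `π` of the product of filter variables that they will multiply.
All other weights are zero. -/
noncomputable def params (π : ℝ) (c : Fin I → ℝ) (a : Fin I → Fin d → ℝ) (b : Fin I → ℝ) :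
    (replicaLayout d n I).Params
  | Sum.inl ⟨⟨0, _⟩, r, s⟩ =>
      Pi.single (M := fun _ : Fin d => ℝ) ((finProdFinEquiv (m := d) (n := n)).symm r).1 1 s
  | Sum.inl ⟨⟨1, _⟩, r, s⟩ =>
      a ((finProdFinEquiv (m := I) (n := n)).symm r).1
        ((finProdFinEquiv (m := d) (n := n)).symm s).1 / (n * π ^ 2)
  | Sum.inl ⟨⟨2, _⟩, _, s⟩ => c ((finProdFinEquiv (m := I) (n := n)).symm s).1 / (n * π)
  | Sum.inr ⟨⟨0, _⟩, _⟩ => 0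
  | Sum.inr ⟨⟨1, _⟩, r⟩ => b ((finProdFinEquiv (m := I) (n := n)).symm r).1
  | Sum.inr ⟨⟨2, _⟩, _⟩ => 0

/-- The three layers written out; the activation functions unfold by computation. -/
theorem eval_eq (w : (replicaLayout d n I).Params) (x : Fin d → ℝ) :
    (replicaLayout d n I).eval w x =
      ∑ r : Fin (I * n), w (Sum.inl ⟨(2 : Fin 3), ((0 : Fin 1), r)⟩) *
        max (∑ s : Fin (d * n), w (Sum.inl ⟨(1 : Fin 3), (r, s)⟩) *
          max (∑ j : Fin d, w (Sum.inl ⟨(0 : Fin 3), (s, j)⟩) * x j +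
            w (Sum.inr ⟨(0 : Fin 3), s⟩)) 0 + w (Sum.inr ⟨(1 : Fin 3), r⟩)) 0 +
      w (Sum.inr ⟨(2 : Fin 3), (0 : Fin 1)⟩) := by
  rfl

/-- The replicated network with filtered weights, on nonnegative inputs. The units of the first
hidden layer then only pass on the product of an input and a filter variable. -/
theorem eval_params_mul (π : ℝ) (c : Fin I → ℝ) (a : Fin I → Fin d → ℝ) (b : Fin I → ℝ)
    (φ : (replicaLayout d n I).Params) (hφ0 : ∀ e, 0 ≤ φ (Sum.inl e)) (hφ : ∀ e, φ (Sum.inr e) = 1)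
    (x : Fin d → ℝ) (hx : 0 ≤ x) :
    (replicaLayout d n I).eval (params π c a b * φ) x =
      ∑ i, ∑ m, c i / (n * π) * φ (Sum.inl (outputEdge i m)) *
        max (∑ j, ∑ k, a i j / (n * π ^ 2) *
          (φ (Sum.inl (hiddenEdge i m j k)) * φ (Sum.inl (inputEdge j k))) * x j + b i) 0 := by
  set w : (replicaLayout d n I).Params := params π c a b * φ
  have h0 : ∀ j k, max (∑ j' : Fin d, w
      (Sum.inl ⟨(0 : Fin 3), (finProdFinEquiv (m := d) (n := n) (j, k), j')⟩) * x j' +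
      w (Sum.inr ⟨(0 : Fin 3), finProdFinEquiv (m := d) (n := n) (j, k)⟩)) 0 =
      φ (Sum.inl (inputEdge j k)) * x j := by
    intro j k
    have h1 : ∀ j' : Fin d, w
        (Sum.inl ⟨(0 : Fin 3), (finProdFinEquiv (m := d) (n := n) (j, k), j')⟩) =
        if j' = j then φ (Sum.inl (inputEdge j k)) else 0 := by
      intro j'
      change Pi.single (M := fun _ : Fin d => ℝ) ((finProdFinEquiv (m := d) (n := n)).symm
        (finProdFinEquiv (m := d) (n := n) (j, k))).1 1 j' * _ = _
      rw [Equiv.symm_apply_apply, Pi.single_apply, ite_mul, one_mul, zero_mul]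
      split_ifs with h
      · subst h; rfl
      · rfl
    have h2 : w
        (Sum.inr ⟨(0 : Fin 3), finProdFinEquiv (m := d) (n := n) (j, k)⟩) = 0 := zero_mul _
    simp only [h1, h2, ite_mul, zero_mul, Finset.sum_ite_eq', Finset.mem_univ, if_true, add_zero]
    exact max_eq_left (mul_nonneg (hφ0 _) (hx j))
  have h3 : w (Sum.inr ⟨(2 : Fin 3), (0 : Fin 1)⟩) = 0 := zero_mul _
  have h4 : ∀ i m, w
      (Sum.inr ⟨(1 : Fin 3), finProdFinEquiv (m := I) (n := n) (i, m)⟩) = b i := by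
    intro i m
    change b ((finProdFinEquiv (m := I) (n := n)).symm
      (finProdFinEquiv (m := I) (n := n) (i, m))).1 * φ (Sum.inr _) = b i
    rw [Equiv.symm_apply_apply, hφ, mul_one]
  have h5 : ∀ i m j k, w
      (Sum.inl ⟨(1 : Fin 3), (finProdFinEquiv (m := I) (n := n) (i, m),
        finProdFinEquiv (m := d) (n := n) (j, k))⟩) =
      a i j / (n * π ^ 2) * φ (Sum.inl (hiddenEdge i m j k)) := by
    intro i m j k
    change a ((finProdFinEquiv (m := I) (n := n)).symm
      (finProdFinEquiv (m := I) (n := n) (i, m))).1 ((finProdFinEquiv (m := d) (n := n)).symm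
      (finProdFinEquiv (m := d) (n := n) (j, k))).1 / _ * _ = _
    rw [Equiv.symm_apply_apply, Equiv.symm_apply_apply]
    rfl
  have h6 : ∀ i m, w
      (Sum.inl ⟨(2 : Fin 3), ((0 : Fin 1), finProdFinEquiv (m := I) (n := n) (i, m))⟩) =
      c i / (n * π) * φ (Sum.inl (outputEdge i m)) := by
    intro i m
    change c ((finProdFinEquiv (m := I) (n := n)).symm
      (finProdFinEquiv (m := I) (n := n) (i, m))).1 / _ * _ = _
    rw [Equiv.symm_apply_apply]
    rfl
  rw [eval_eq, h3, add_zero, ← (finProdFinEquiv (m := I) (n := n)).sum_comp,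
    Fintype.sum_prod_type]
  refine Finset.sum_congr rfl fun i _ => Finset.sum_congr rfl fun m _ => ?_
  rw [h6, h4, ← (finProdFinEquiv (m := d) (n := n)).sum_comp, Fintype.sum_prod_type]
  congr 3
  refine Finset.sum_congr rfl fun j _ => Finset.sum_congr rfl fun k _ => ?_
  rw [h5, h0]
  ring

end replicaLayout

/-! ### Perturbation of the coefficients -/

/-- The bound for the distance between a shallow network and its replicated version, in terms of
the deviation `U i m j` of the scaling of the signal from the input `j` to the copy `m` of the unit
`i`, and the deviation `V i` of the scaling of the signals from the copies of the unit `i` to the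
output. -/
noncomputable def deviationBound {d n I : ℕ} (π : ℝ) (c : Fin I → ℝ) (a : Fin I → Fin d → ℝ)
    (b : Fin I → ℝ) (U : Fin I → Fin n → Fin d → ℝ) (V : Fin I → ℝ) : ℝ :=
  ∑ i, ∑ m, |c i| / (n * π) * ∑ j, |a i j| * U i m j + ∑ i, |c i| * (∑ j, |a i j| + |b i|) * V i

/-- The distance between a shallow network and its replicated version, when the signals on the way
from the inputs and on the way to the output are multiplied by `φ₁` and `φ₂`, is governed by the
deviations of the averages of these factors from their targets. The input `x` does not enter the
bound. -/
theorem abs_replicated_sub_shallow_le {d n I : ℕ} (π : ℝ) (hπ : 0 < π) (c : Fin I → ℝ)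
    (a : Fin I → Fin d → ℝ) (b : Fin I → ℝ) (φ₁ : Fin I → Fin n → Fin d → Fin n → ℝ)
    (φ₂ : Fin I → Fin n → ℝ) (h₂ : ∀ i m, φ₂ i m ∈ Set.Icc (0 : ℝ) 1)
    (x : Fin d → ℝ) (hx : x ∈ Set.Icc (0 : Fin d → ℝ) 1) :
    |∑ i, ∑ m, c i / (n * π) * φ₂ i m *
        max (∑ j, ∑ k, a i j / (n * π ^ 2) * φ₁ i m j k * x j + b i) 0 -
      ∑ i, c i * max (∑ j, a i j * x j + b i) 0| ≤
    deviationBound π c a b (fun i m j => |(∑ k, φ₁ i m j k) / (n * π ^ 2) - 1|)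
      (fun i => |(∑ m, φ₂ i m) / (n * π) - 1|) := by
  have hxj : ∀ j, |x j| ≤ 1 := fun j => by
    rw [abs_of_nonneg (hx.1 j)]
    exact hx.2 j
  rw [deviationBound, ← Finset.sum_sub_distrib, ← Finset.sum_add_distrib]
  refine (Finset.abs_sum_le_sum_abs _ _).trans (Finset.sum_le_sum fun i _ => ?_)
  set h := max (∑ j, a i j * x j + b i) 0
  set g := fun m => max (∑ j, ∑ k, a i j / (n * π ^ 2) * φ₁ i m j k * x j + b i) 0
  have hsplit : ∑ m, c i / (n * π) * φ₂ i m * g m - c i * h =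
      ∑ m, c i / (n * π) * (φ₂ i m * (g m - h)) +
        c i * h * ((∑ m, φ₂ i m) / (n * π) - 1) := by
    simp only [mul_sub, Finset.sum_sub_distrib, ← mul_assoc]
    rw [← Finset.sum_mul, ← Finset.mul_sum]
    ring
  have hgh : ∀ m, |g m - h| ≤ ∑ j, |a i j| * |(∑ k, φ₁ i m j k) / (n * π ^ 2) - 1| := by
    intro m
    refine (abs_max_sub_max_le_abs _ _ _).trans ?_
    rw [add_sub_add_right_eq_sub, ← Finset.sum_sub_distrib]
    refine (Finset.abs_sum_le_sum_abs _ _).trans (Finset.sum_le_sum fun j _ => ?_)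
    rw [← Finset.sum_mul, ← Finset.mul_sum]
    rw [show a i j / (n * π ^ 2) * (∑ k, φ₁ i m j k) * x j - a i j * x j =
      a i j * ((∑ k, φ₁ i m j k) / (n * π ^ 2) - 1) * x j by ring, abs_mul, abs_mul]
    exact mul_le_of_le_one_right (by positivity) (hxj j)
  have hhb : |h| ≤ ∑ j, |a i j| + |b i| := by
    rw [abs_of_nonneg (le_max_right _ _)]
    refine max_le ?_ (by positivity)
    refine (le_abs_self _).trans ((abs_add_le _ _).trans ?_)
    gcongr
    refine (Finset.abs_sum_le_sum_abs _ _).trans (Finset.sum_le_sum fun j _ => ?_)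
    rw [abs_mul]
    exact mul_le_of_le_one_right (by positivity) (hxj j)
  rw [hsplit]
  refine (abs_add_le _ _).trans (add_le_add ?_ ?_)
  · refine (Finset.abs_sum_le_sum_abs _ _).trans (Finset.sum_le_sum fun m _ => ?_)
    rw [abs_mul, abs_div, abs_of_nonneg (by positivity : 0 ≤ n * π)]
    gcongr
    rw [abs_mul, abs_of_nonneg (h₂ i m).1]
    exact (mul_le_of_le_one_left (abs_nonneg _) (h₂ i m).2).trans (hgh m)
  · rw [abs_mul, abs_mul]
    gcongr

theorem deviationBound_nonneg {d n I : ℕ} {π : ℝ} (hπ : 0 < π) (c : Fin I → ℝ)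
    (a : Fin I → Fin d → ℝ) (b : Fin I → ℝ) {U : Fin I → Fin n → Fin d → ℝ} {V : Fin I → ℝ}
    (hU : ∀ i m j, 0 ≤ U i m j) (hV : ∀ i, 0 ≤ V i) : 0 ≤ deviationBound π c a b U V := by
  refine add_nonneg (Finset.sum_nonneg fun i _ => Finset.sum_nonneg fun m _ => ?_)
    (Finset.sum_nonneg fun i _ => mul_nonneg (by positivity) (hV i))
  exact mul_nonneg (by positivity)
    (Finset.sum_nonneg fun j _ => mul_nonneg (abs_nonneg _) (hU i m j))

/-- The number `K`, which does not depend on the number of copies, such that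
`deviationBound π c a b U V ≤ K * τ` whenever `U ≤ τ / π ^ 2` and `V ≤ τ / π`. -/
noncomputable def deviationConst {d I : ℕ} (π : ℝ) (c : Fin I → ℝ) (a : Fin I → Fin d → ℝ)
    (b : Fin I → ℝ) : ℝ :=
  ∑ i, |c i| / π * ∑ j, |a i j| * (1 / π ^ 2) + ∑ i, |c i| * (∑ j, |a i j| + |b i|) * (1 / π)

theorem deviationConst_nonneg {d I : ℕ} {π : ℝ} (hπ : 0 < π) (c : Fin I → ℝ)
    (a : Fin I → Fin d → ℝ) (b : Fin I → ℝ) : 0 ≤ deviationConst π c a b := by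
  unfold deviationConst
  positivity

theorem deviationBound_le {d n I : ℕ} (hn : 0 < n) {π : ℝ} (hπ : 0 < π) (c : Fin I → ℝ)
    (a : Fin I → Fin d → ℝ) (b : Fin I → ℝ) {U : Fin I → Fin n → Fin d → ℝ} {V : Fin I → ℝ}
    {τ : ℝ} (hU : ∀ i m j, U i m j ≤ 1 / π ^ 2 * τ) (hV : ∀ i, V i ≤ 1 / π * τ) :
    deviationBound π c a b U V ≤ deviationConst π c a b * τ := by
  have hn' : (n : ℝ) ≠ 0 := by exact_mod_cast hn.ne'
  rw [deviationBound, deviationConst, add_mul, Finset.sum_mul, Finset.sum_mul]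
  refine add_le_add (Finset.sum_le_sum fun i _ => ?_) (Finset.sum_le_sum fun i _ => ?_)
  · calc _ ≤ ∑ _m : Fin n, |c i| / (n * π) * ∑ j, |a i j| * (1 / π ^ 2 * τ) := by
          gcongr with m _ j _
          exact hU i m j
      _ = _ := by
          simp only [← mul_assoc, ← Finset.sum_mul]
          rw [Finset.sum_const, Finset.card_univ, Fintype.card_fin, nsmul_eq_mul]
          field_simp
  · rw [mul_assoc _ (1 / π)]
    exact mul_le_mul_of_nonneg_left (hV i) (by positivity)

theorem integral_deviationBound {d n I : ℕ} {Ω : Type*} [MeasurableSpace Ω] {P : Measure Ω}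
    (π : ℝ) (c : Fin I → ℝ) (a : Fin I → Fin d → ℝ) (b : Fin I → ℝ)
    {U : Ω → Fin I → Fin n → Fin d → ℝ} {V : Ω → Fin I → ℝ}
    (hU : ∀ i m j, Integrable (fun ω => U ω i m j) P) (hV : ∀ i, Integrable (fun ω => V ω i) P) :
    ∫ ω, deviationBound π c a b (U ω) (V ω) ∂P =
      deviationBound π c a b (fun i m j => ∫ ω, U ω i m j ∂P) (fun i => ∫ ω, V ω i ∂P) := by
  have hU1 : ∀ i m, Integrable (fun ω => |c i| / (n * π) * ∑ j, |a i j| * U ω i m j) P :=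
    fun i m => (integrable_finsetSum _ fun j _ => (hU i m j).const_mul _).const_mul _
  have hU2 : ∀ i, Integrable (fun ω => ∑ m, |c i| / (n * π) * ∑ j, |a i j| * U ω i m j) P :=
    fun i => integrable_finsetSum _ fun m _ => hU1 i m
  have hV1 : ∀ i, Integrable (fun ω => |c i| * (∑ j, |a i j| + |b i|) * V ω i) P :=
    fun i => (hV i).const_mul _
  unfold deviationBound
  rw [integral_add (integrable_finsetSum _ fun i _ => hU2 i)
      (integrable_finsetSum _ fun i _ => hV1 i),
    integral_finsetSum _ fun i _ => hU2 i, integral_finsetSum _ fun i _ => hV1 i]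
  congr 1
  · refine Finset.sum_congr rfl fun i _ => ?_
    rw [integral_finsetSum _ fun m _ => hU1 i m]
    refine Finset.sum_congr rfl fun m _ => ?_
    rw [integral_const_mul, integral_finsetSum _ fun j _ => (hU i m j).const_mul _]
    simp only [integral_const_mul]
  · simp only [integral_const_mul]

/-! ### A law of large numbers with rate -/

theorem abs_div_sub_one_le {π y : ℝ} {n : ℕ} (hn : 0 < n) (hπ : 0 < π) (hπ1 : π ≤ 1)
    (hy0 : 0 ≤ y) (hy1 : y ≤ n) : |y / (n * π) - 1| ≤ 1 / π := by
  have hn' : (0 : ℝ) < n := by exact_mod_cast hn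
  have h1 : 1 ≤ 1 / π := one_le_one_div hπ hπ1
  have h2 : y / (n * π) ≤ 1 / π := by
    rw [div_le_div_iff₀ (by positivity) hπ]
    nlinarith
  have h3 : 0 ≤ y / (n * π) := by positivity
  rw [abs_le]
  constructor <;> linarith

/-- A weak law of large numbers with rate, from Chebyshev's variance argument. -/
theorem integral_abs_mean_div_sub_one_le {Ω : Type*} [MeasurableSpace Ω] (P : Measure Ω)
    [IsProbabilityMeasure P] {n : ℕ} (hn : 0 < n) {X : Fin n → Ω → ℝ}
    (hX : ∀ k, Measurable (X k)) (h01 : ∀ k ω, X k ω ∈ Set.Icc (0 : ℝ) 1)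
    (hind : Pairwise fun k l => IndepFun (X k) (X l) P) {π : ℝ} (hπ : 0 < π)
    (hE : ∀ k, ∫ ω, X k ω ∂P = π) :
    ∫ ω, |(∑ k, X k ω) / (n * π) - 1| ∂P ≤ 1 / π / √n := by
  have hn' : (0 : ℝ) < n := by exact_mod_cast hn
  have hL2 : ∀ k, MemLp (X k) 2 P := fun k => MemLp.of_bound (hX k).aestronglyMeasurable 1
    (ae_of_all _ fun ω => by
      rw [Real.norm_eq_abs, abs_of_nonneg (h01 k ω).1]; exact (h01 k ω).2)
  have hmean : ∫ ω, ∑ k, X k ω ∂P = n * π := by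
    rw [integral_finsetSum _ fun k _ => (hL2 k).integrable (by norm_num)]
    simp [hE]
  have hS : MemLp (fun ω => ∑ k, X k ω) 2 P := memLp_finsetSum _ fun k _ => hL2 k
  have hvar : ∫ ω, (∑ k, X k ω - n * π) ^ 2 ∂P ≤ n := by
    have h := IndepFun.variance_sum (s := Finset.univ) (fun k _ => hL2 k)
      (fun k _ l _ hkl => hind hkl)
    have h1 : ∀ k, Var[X k; P] ≤ 1 := fun k =>
      (variance_le_sq_of_bounded (ae_of_all _ (h01 k)) (hX k).aemeasurable).trans (by norm_num)
    calc _ = Var[∑ k, X k; P] := by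
          rw [variance_eq_integral (Finset.aemeasurable_sum _ fun k _ => (hX k).aemeasurable)]
          simp only [Finset.sum_apply, hmean]
      _ ≤ n := by
          rw [h]
          exact (Finset.sum_le_sum fun k _ => h1 k).trans (by simp)
  have hint2 : Integrable (fun ω => (∑ k, X k ω - n * π) ^ 2) P :=
    (hS.sub (memLp_const _)).integrable_sq
  have hint : Integrable (fun ω => |(∑ k, X k ω) / (n * π) - 1|) P :=
    (((hS.integrable (by norm_num)).div_const _).sub (integrable_const _)).abs
  have hs : 0 < √(n : ℝ) := Real.sqrt_pos.2 hn'
  have hss : √(n : ℝ) * √n = n := Real.mul_self_sqrt hn'.le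
  -- `|t| ≤ (t ^ 2 / √n + √n) / 2` with `t` the centred sum
  have hpt : ∀ ω, |(∑ k, X k ω) / (n * π) - 1| ≤
      ((∑ k, X k ω - n * π) ^ 2 / √n + √n) / 2 / (n * π) := by
    intro ω
    set t := ∑ k, X k ω - n * π with ht
    have h1 : (∑ k, X k ω) / (n * π) - 1 = t / (n * π) := by
      rw [ht]; field_simp
    rw [h1, abs_div, abs_of_pos (by positivity : 0 < n * π)]
    gcongr
    have h2 : t ^ 2 / √n + √n = (t ^ 2 + n) / √n := by
      rw [add_div, ← hss, mul_div_assoc, hss, div_self hs.ne', mul_one]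
    rw [h2, div_div, le_div_iff₀ (by positivity)]
    nlinarith [sq_nonneg (|t| - √n), sq_abs t, hss]
  calc _ ≤ ∫ ω, ((∑ k, X k ω - n * π) ^ 2 / √n + √n) / 2 / (n * π) ∂P :=
        integral_mono hint
          ((((hint2.div_const _).add (integrable_const _)).div_const _).div_const _) hpt
    _ = ((∫ ω, (∑ k, X k ω - n * π) ^ 2 ∂P) / √n + √n) / 2 / (n * π) := by
        rw [integral_div, integral_div, integral_add (hint2.div_const _) (integrable_const _),
          integral_div]
        simp
    _ ≤ (n / √n + √n) / 2 / (n * π) := by gcongr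
    _ = 1 / π / √n := by
        rw [show (n : ℝ) / √n = √n by rw [div_eq_iff hs.ne', hss]]
        field_simp
        nlinarith [hss]

/-! ### Dropconnect filters -/

namespace NetLayout.IsDropconnectFilter

variable {d : ℕ} {N : NetLayout d} {Ω : Type*} [MeasurableSpace Ω] {P : Measure Ω} {p : ℝ}
  {f : Ω → N.Params}

theorem measurable_weight (hf : N.IsDropconnectFilter P p f) (e : N.WeightIndex) :
    Measurable fun ω => f ω (Sum.inl e) :=
  (measurable_pi_apply _).comp hf.measurable

theorem mem_Icc (hf : N.IsDropconnectFilter P p f) (ω : Ω) (i) : f ω i ∈ Set.Icc (0 : ℝ) 1 := by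
  rcases hf.zero_or_one ω i with h | h <;> simp [h]

theorem ae_bias_one (hf : N.IsDropconnectFilter P p f) :
    ∀ᵐ ω ∂P, ∀ b : N.BiasIndex, f ω (Sum.inr b) = 1 :=
  ae_all_iff.2 hf.bias_one

theorem integral_weight (hf : N.IsDropconnectFilter P p f) (hp1 : p ≤ 1) (e : N.WeightIndex) :
    ∫ ω, f ω (Sum.inl e) ∂P = 1 - p := by
  have h : (fun ω => f ω (Sum.inl e)) = Set.indicator {ω | f ω (Sum.inl e) = 1} 1 := by
    ext ω
    rcases hf.zero_or_one ω (Sum.inl e) with h | h <;> simp [Set.indicator, h]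
  have hm : MeasurableSet {ω | f ω (Sum.inl e) = 1} :=
    hf.measurable_weight e (measurableSet_singleton 1)
  rw [h, integral_indicator_one hm, Measure.real, hf.weight_prob,
    ENNReal.toReal_ofReal (by linarith)]

theorem expectedFilter_inl (hf : N.IsDropconnectFilter P p f) (hp1 : p ≤ 1) (e : N.WeightIndex) :
    N.expectedFilter P f (Sum.inl e) = 1 - p :=
  hf.integral_weight hp1 e

theorem expectedFilter_inr [IsProbabilityMeasure P] (hf : N.IsDropconnectFilter P p f)
    (b : N.BiasIndex) : N.expectedFilter P f (Sum.inr b) = 1 := by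
  rw [expectedFilter, integral_congr_ae (hf.bias_one b)]
  simp

theorem integral_weight_mul_weight [IsProbabilityMeasure P] (hf : N.IsDropconnectFilter P p f)
    (hp1 : p ≤ 1) {e e' : N.WeightIndex} (h : e ≠ e') :
    ∫ ω, f ω (Sum.inl e) * f ω (Sum.inl e') ∂P = (1 - p) ^ 2 := by
  rw [(hf.weight_indep.indepFun h).integral_fun_mul_eq_mul_integral
    (hf.measurable_weight e).aestronglyMeasurable (hf.measurable_weight e').aestronglyMeasurable,
    hf.integral_weight hp1, hf.integral_weight hp1, sq]

/-- A filter takes finitely many values, so every function of it is a random variable. -/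
theorem measurable_comp (hf : N.IsDropconnectFilter P p f) (Φ : N.Params → ℝ) :
    Measurable fun ω => Φ (f ω) := by
  have hb : Measurable fun ω i => decide (f ω i = 1) := by
    refine measurable_pi_lambda _ fun i => measurable_to_bool ?_
    convert! (measurable_pi_apply i).comp hf.measurable (measurableSet_singleton 1) using 1
    ext ω
    simp
  have h : (fun ω => Φ (f ω)) = (fun β : N.WeightIndex ⊕ N.BiasIndex → Bool =>
      Φ fun i => if β i then 1 else 0) ∘ fun ω i => decide (f ω i = 1) := by
    ext ω
    refine congrArg Φ (funext fun i => ?_)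
    rcases hf.zero_or_one ω i with h | h <;> simp [h]
  rw [h]
  exact (measurable_of_countable _).comp hb

end NetLayout.IsDropconnectFilter

/-- Dropconnect filters exist: take independent Bernoulli variables on a product space. -/
theorem NetLayout.exists_isDropconnectFilter {d : ℕ} (N : NetLayout d) {p : ℝ} (hp0 : 0 ≤ p)
    (hp1 : p ≤ 1) :
    ∃ (Ω : Type) (_ : MeasurableSpace Ω) (P : Measure Ω) (_ : IsProbabilityMeasure P)
      (f : Ω → N.Params), N.IsDropconnectFilter P p f := by
  let μ : Measure Bool := ENNReal.ofReal (1 - p) • Measure.dirac true +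
    ENNReal.ofReal p • Measure.dirac false
  have hμ : IsProbabilityMeasure μ := ⟨by
    simp only [μ, Measure.add_apply, Measure.smul_apply, measure_univ, smul_eq_mul, mul_one]
    rw [← ENNReal.ofReal_add (by linarith) hp0]
    simp⟩
  have hm : ∀ e : N.WeightIndex, Measurable fun ω : N.WeightIndex → Bool =>
      if ω e then (1 : ℝ) else 0 := fun e =>
    (measurable_of_countable fun β : Bool => if β then (1 : ℝ) else 0).comp (measurable_pi_apply e)
  refine ⟨N.WeightIndex → Bool, inferInstance, Measure.pi fun _ => μ, inferInstance,
    fun ω => Sum.elim (fun e => if ω e then 1 else 0) fun _ => 1, ?_, ?_, ?_, ?_, ?_⟩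
  · refine measurable_pi_lambda _ ?_
    rintro (e | b)
    · exact hm e
    · exact measurable_const
  · rintro ω (e | b)
    · simp only [Sum.elim_inl]
      split_ifs <;> simp
    · simp
  · intro e
    have h : {ω : N.WeightIndex → Bool | (Sum.elim (fun e => if ω e then 1 else 0) fun _ => 1 :
        N.Params) (Sum.inl e) = 1} = (fun ω => ω e) ⁻¹' {true} := by
      ext ω
      simp
    rw [h, (measurePreserving_eval (fun _ : N.WeightIndex => μ) e).measure_preimage
      (measurableSet_singleton _).nullMeasurableSet]
    simp [μ]
  · exact iIndepFun_pi (μ := fun _ : N.WeightIndex => μ)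
      (X := fun _ β => if β then (1 : ℝ) else 0) fun _ => (measurable_of_countable _).aemeasurable
  · exact fun b => ae_of_all _ fun ω => rfl

/-! ### From a small mean to smallness in probability and in `L^q` -/

/-- Sufficient conditions for a bounded random error `X` to be small in probability and in `L^q`:
up to a small constant it is dominated by a bounded random variable of small mean. -/
theorem error_small {ε q K : ℝ} (hε : 0 < ε) (hq : 1 ≤ q) (hK : 0 ≤ K) :
    ∃ δ > 0, ∀ (Ω : Type*) [MeasurableSpace Ω] (P : Measure Ω) [IsProbabilityMeasure P]
      (X R : Ω → ℝ), Measurable X → Measurable R → (∀ ω, 0 ≤ X ω) → (∀ ω, 0 ≤ R ω) →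
      (∀ ω, R ω ≤ K) → (∀ᵐ ω ∂P, X ω ≤ ε / 2 + R ω) → ∫ ω, R ω ∂P < δ →
      P {ω | X ω > ε} < ENNReal.ofReal ε ∧ Integrable (fun ω => X ω ^ q) P ∧
        (∫ ω, X ω ^ q ∂P) ^ (1 / q) < ε := by
  have hq0 : 0 < q := by linarith
  set B := (ε / 2 + K) ^ q * (4 / ε) with hB
  have hB0 : 0 ≤ B := by positivity
  have hgap : 0 < ε ^ q - (3 * ε / 4) ^ q :=
    sub_pos.2 (Real.rpow_lt_rpow (by positivity) (by linarith) hq0)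
  refine ⟨min (ε ^ 2 / 2) ((ε ^ q - (3 * ε / 4) ^ q) / (B + 1)), by positivity, ?_⟩
  intro Ω _ P _ X R hX hR hX0 hR0 hRK hXR hδ
  have hδ1 := hδ.trans_le (min_le_left _ _)
  have hδ2 := hδ.trans_le (min_le_right _ _)
  have hRint : Integrable R P := Integrable.of_bound hR.aestronglyMeasurable K
    (ae_of_all _ fun ω => by rw [Real.norm_eq_abs, abs_of_nonneg (hR0 ω)]; exact hRK ω)
  have hXint : Integrable (fun ω => X ω ^ q) P :=
    Integrable.of_bound (hX.pow_const q).aestronglyMeasurable ((ε / 2 + K) ^ q) (by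
      filter_upwards [hXR] with ω hω
      rw [Real.norm_eq_abs, abs_of_nonneg (Real.rpow_nonneg (hX0 ω) q)]
      exact Real.rpow_le_rpow (hX0 ω) (hω.trans (by linarith [hRK ω])) hq0.le)
  refine ⟨?_, hXint, ?_⟩
  · have h1 : P {ω | X ω > ε} ≤ P {ω | ε / 2 ≤ R ω} := by
      refine measure_mono_ae ?_
      filter_upwards [hXR] with ω hω h
      have h' : X ω > ε := h
      show ε / 2 ≤ R ω
      linarith
    have h2 := mul_meas_ge_le_integral_of_nonneg (ae_of_all _ hR0) hRint (ε / 2)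
    refine h1.trans_lt ?_
    rw [← ENNReal.ofReal_toReal (measure_ne_top P {ω | ε / 2 ≤ R ω})]
    refine (ENNReal.ofReal_lt_ofReal_iff hε).2 ?_
    change P.real {ω | ε / 2 ≤ R ω} < ε
    nlinarith
  · -- split according to whether `R ≤ ε / 4`
    have hpt : ∀ᵐ ω ∂P, X ω ^ q ≤ (3 * ε / 4) ^ q + B * R ω := by
      filter_upwards [hXR] with ω hω
      rcases le_total (R ω) (ε / 4) with h | h
      · have := Real.rpow_le_rpow (hX0 ω) (by linarith : X ω ≤ 3 * ε / 4) hq0.le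
        have := mul_nonneg hB0 (hR0 ω)
        linarith
      · have h1 := Real.rpow_le_rpow (hX0 ω) (hω.trans (by linarith [hRK ω]) :
          X ω ≤ ε / 2 + K) hq0.le
        have h2 : 1 ≤ 4 / ε * R ω := by
          rw [div_mul_eq_mul_div, le_div_iff₀ hε]
          linarith
        have h3 : 0 ≤ (ε / 2 + K) ^ q := by positivity
        have h4 : 0 ≤ (3 * ε / 4) ^ q := by positivity
        rw [hB, mul_assoc]
        nlinarith
    have hle : ∫ ω, X ω ^ q ∂P ≤ (3 * ε / 4) ^ q + B * ∫ ω, R ω ∂P := by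
      refine (integral_mono_ae hXint ((integrable_const _).add (hRint.const_mul B)) hpt).trans ?_
      rw [integral_add' (integrable_const _) (hRint.const_mul B), integral_const_mul]
      simp
    have hlt : ∫ ω, X ω ^ q ∂P < ε ^ q := by
      have h0 : 0 ≤ ∫ ω, R ω ∂P := integral_nonneg hR0
      rw [lt_div_iff₀ (by positivity)] at hδ2
      nlinarith
    calc _ < (ε ^ q) ^ (1 / q) := Real.rpow_lt_rpow
          (integral_nonneg fun ω => Real.rpow_nonneg (hX0 ω) q) hlt (by positivity)
      _ = ε := by rw [one_div, Real.rpow_rpow_inv hε.le hq0.ne']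

/-! ### The replicated network under dropconnect -/

theorem cubeSup_le {d : ℕ} {g : C(Fin d → ℝ, ℝ)} {B : ℝ}
    (h : ∀ x ∈ Set.Icc (0 : Fin d → ℝ) 1, |g x| ≤ B) : cubeSup g ≤ B :=
  haveI : Nonempty (Set.Icc (0 : Fin d → ℝ) 1) := ⟨0, le_rfl, zero_le_one⟩
  ciSup_le fun x => h x x.2

theorem cubeSup_nonneg {d : ℕ} (g : C(Fin d → ℝ, ℝ)) : 0 ≤ cubeSup g :=
  Real.iSup_nonneg fun _ => abs_nonneg _

namespace replicaLayout

variable {d n I : ℕ}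

/-- The bound, uniform in the input, for the distance between a shallow network and the replicated
network with filter `φ`. -/
noncomputable def filterError (π : ℝ) (c : Fin I → ℝ) (a : Fin I → Fin d → ℝ) (b : Fin I → ℝ)
    (φ : (replicaLayout d n I).Params) : ℝ :=
  deviationBound π c a b
    (fun i m j => |(∑ k : Fin n, φ (Sum.inl (hiddenEdge i m j k)) * φ (Sum.inl (inputEdge j k))) /
      (n * π ^ 2) - 1|)
    (fun i => |(∑ m : Fin n, φ (Sum.inl (outputEdge i m))) / (n * π) - 1|)

theorem filterError_nonneg {π : ℝ} (hπ : 0 < π) (c : Fin I → ℝ) (a : Fin I → Fin d → ℝ)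
    (b : Fin I → ℝ) (φ : (replicaLayout d n I).Params) : 0 ≤ filterError π c a b φ :=
  deviationBound_nonneg hπ c a b (fun _ _ _ => abs_nonneg _) fun _ => abs_nonneg _

theorem filterError_le (hn : 0 < n) {π : ℝ} (hπ : 0 < π) (hπ1 : π ≤ 1) (c : Fin I → ℝ)
    (a : Fin I → Fin d → ℝ) (b : Fin I → ℝ) {φ : (replicaLayout d n I).Params}
    (hφ : ∀ e, φ e ∈ Set.Icc (0 : ℝ) 1) : filterError π c a b φ ≤ deviationConst π c a b := by
  refine (deviationBound_le (τ := 1) hn hπ c a b (fun i m j => ?_) fun i => ?_).trans_eq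
    (mul_one _)
  · rw [mul_one]
    refine abs_div_sub_one_le hn (by positivity) (pow_le_one₀ hπ.le hπ1)
      (Finset.sum_nonneg fun k _ => mul_nonneg (hφ _).1 (hφ _).1) ?_
    exact (Finset.sum_le_sum fun k _ => mul_le_one₀ (hφ _).2 (hφ _).1 (hφ _).2).trans (by simp)
  · rw [mul_one]
    refine abs_div_sub_one_le hn hπ hπ1 (Finset.sum_nonneg fun k _ => (hφ _).1) ?_
    exact (Finset.sum_le_sum fun k _ => (hφ _).2).trans (by simp)

/-- The mean error decays like the inverse square root of the number of copies. -/
theorem integral_filterError_le {Ω : Type*} [MeasurableSpace Ω] {P : Measure Ω}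
    [IsProbabilityMeasure P] (hn : 0 < n) {p : ℝ} (hp1 : p < 1)
    {f : Ω → (replicaLayout d n I).Params}
    (hf : (replicaLayout d n I).IsDropconnectFilter P p f) (c : Fin I → ℝ) (a : Fin I → Fin d → ℝ)
    (b : Fin I → ℝ) :
    ∫ ω, filterError (1 - p) c a b (f ω) ∂P ≤ deviationConst (1 - p) c a b * (1 / √n) := by
  have hπ : 0 < 1 - p := by linarith
  have hm := hf.measurable_weight
  have h01 := hf.mem_Icc
  have hprod : ∀ i m j (k : Fin n), Measurable fun ω =>
      f ω (Sum.inl (hiddenEdge i m j k)) * f ω (Sum.inl (inputEdge j k)) :=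
    fun i m j k => (hm _).mul (hm _)
  have hprod01 : ∀ (i : Fin I) (m : Fin n) (j : Fin d) (k : Fin n) (ω : Ω),
      f ω (Sum.inl (hiddenEdge i m j k)) * f ω (Sum.inl (inputEdge j k)) ∈ Set.Icc (0 : ℝ) 1 :=
    fun i m j k ω => ⟨mul_nonneg (h01 ω _).1 (h01 ω _).1,
      mul_le_one₀ (h01 ω _).2 (h01 ω _).1 (h01 ω _).2⟩
  have hint : ∀ {g : Ω → ℝ}, Measurable g → (∀ ω, g ω ∈ Set.Icc (0 : ℝ) 1) → Integrable g P :=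
    fun hg hg01 => Integrable.of_bound hg.aestronglyMeasurable 1 (ae_of_all _ fun ω => by
      rw [Real.norm_eq_abs, abs_of_nonneg (hg01 ω).1]; exact (hg01 ω).2)
  unfold filterError
  rw [integral_deviationBound]
  · refine deviationBound_le hn hπ c a b (fun i m j => ?_) fun i => ?_
    · rw [mul_one_div]
      refine integral_abs_mean_div_sub_one_le P hn (hprod i m j) (hprod01 i m j) ?_
        (by positivity) fun k => hf.integral_weight_mul_weight hp1.le
          (hiddenEdge_ne_inputEdge i m j j k k)
      exact fun k l hkl => hf.weight_indep.indepFun_mul_mul hm _ _ _ _ (hiddenEdge_ne hkl)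
        (hiddenEdge_ne_inputEdge _ _ _ _ _ _) (hiddenEdge_ne_inputEdge _ _ _ _ _ _).symm
        (inputEdge_ne hkl)
    · rw [mul_one_div]
      exact integral_abs_mean_div_sub_one_le P hn (fun m => hm _) (fun m ω => h01 ω _)
        (fun m m' h => hf.weight_indep.indepFun (outputEdge_ne h)) hπ
        fun m => hf.integral_weight hp1.le _
  · exact fun i m j => (((integrable_finsetSum _ fun k _ =>
      hint (hprod i m j k) (hprod01 i m j k)).div_const _).sub (integrable_const _)).abs
  · exact fun i => (((integrable_finsetSum _ fun m _ =>
      hint (hm _) fun ω => h01 ω _).div_const _).sub (integrable_const _)).abs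

/-- On the cube, a replicated network with filter `φ` differs from `ζ` by at most the error of the
shallow network and the deviation caused by `φ`. -/
theorem cubeSup_sub_le {π : ℝ} (hπ : 0 < π) {c : Fin I → ℝ} {a : Fin I → Fin d → ℝ}
    {b : Fin I → ℝ} {ζ : C(Fin d → ℝ, ℝ)} {η : ℝ}
    (hζ : ∀ x : Cube d, |∑ i, c i * max (∑ j, a i j * x.1 j + b i) 0 - ζ x.1| ≤ η)
    {φ : (replicaLayout d n I).Params} (hφ : ∀ e, φ e ∈ Set.Icc (0 : ℝ) 1)
    (hφ1 : ∀ e, φ (Sum.inr e) = 1) :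
    cubeSup ((replicaLayout d n I).reluNet (params π c a b * φ) - ζ) ≤
      η + filterError π c a b φ := by
  refine cubeSup_le fun x hx => ?_
  have h1 := abs_replicated_sub_shallow_le π hπ c a b
    (fun i m j k => φ (Sum.inl (hiddenEdge i m j k)) * φ (Sum.inl (inputEdge j k)))
    (fun i m => φ (Sum.inl (outputEdge i m))) (fun i m => hφ _) x hx
  rw [← eval_params_mul π c a b φ (fun e => (hφ _).1) hφ1 x hx.1] at h1
  have h2 := abs_sub_le ((replicaLayout d n I).eval (params π c a b * φ) x)
    (∑ i, c i * max (∑ j, a i j * x j + b i) 0) (ζ x)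
  have h3 := hζ ⟨x, hx⟩
  change |(replicaLayout d n I).eval (params π c a b * φ) x - ζ x| ≤ _
  unfold filterError
  linarith

/-- The averages of the expected filter have no deviation from their targets. -/
theorem filterError_const (hn : 0 < n) {π : ℝ} (hπ : 0 < π) (c : Fin I → ℝ)
    (a : Fin I → Fin d → ℝ) (b : Fin I → ℝ) {φ : (replicaLayout d n I).Params}
    (hφ : ∀ e, φ (Sum.inl e) = π) : filterError π c a b φ = 0 := by
  have hn' : (n : ℝ) ≠ 0 := by exact_mod_cast hn.ne'
  have h1 : (n : ℝ) * (π * π) / (n * π ^ 2) = 1 := by field_simp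
  have h2 : (n : ℝ) * π / (n * π) = 1 := by field_simp
  simp [filterError, deviationBound, hφ, h1, h2]

end replicaLayout

open replicaLayout

theorem corollary1p3 {d : ℕ} (ζ : C(Fin d → ℝ, ℝ)) (ε : ℝ) (hε : 0 < ε)
    (q : ℝ) (hq : 1 ≤ q) (p : ℝ) (hp0 : 0 ≤ p) (hp1 : p < 1) :
    ∃ (N : NetLayout d) (w : N.Params),
      (∃ (Ω : Type) (_ : MeasurableSpace Ω) (P : Measure Ω) (_ : IsProbabilityMeasure P)
        (f : Ω → N.Params), N.IsDropconnectFilter P p f) ∧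
      ∀ (Ω : Type*) [MeasurableSpace Ω] (P : Measure Ω) [IsProbabilityMeasure P]
        (f : Ω → N.Params), N.IsDropconnectFilter P p f →
        P {ω | cubeSup (N.reluNet (w * f ω) - ζ) > ε} < ENNReal.ofReal ε ∧
        Integrable (fun ω => cubeSup (N.reluNet (w * f ω) - ζ) ^ q) P ∧
        (∫ ω, cubeSup (N.reluNet (w * f ω) - ζ) ^ q ∂P) ^ (1 / q) < ε ∧
        cubeSup (N.reluNet (w * N.expectedFilter P f) - ζ) < ε := by
  obtain ⟨I, c, a, b, hζ⟩ := exists_shallow_near ζ (half_pos hε)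
  have hπ : 0 < 1 - p := by linarith
  have hK := deviationConst_nonneg hπ c a b
  obtain ⟨δ, hδ, hsmall⟩ := error_small hε hq hK
  -- the required mean error `δ` does not depend on the number `n` of copies, chosen last
  obtain ⟨n, hn, hnδ⟩ : ∃ n : ℕ, 0 < n ∧ deviationConst (1 - p) c a b * (1 / √n) < δ := by
    have h : Filter.Tendsto (fun n : ℕ => deviationConst (1 - p) c a b * (1 / √(n : ℝ)))
        Filter.atTop (nhds (deviationConst (1 - p) c a b * 0)) := by
      simp only [one_div]
      exact ((tendsto_inv_atTop_zero.comp Real.tendsto_sqrt_atTop).comp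
        tendsto_natCast_atTop_atTop).const_mul _
    rw [mul_zero] at h
    exact ((Filter.eventually_gt_atTop 0).and (h.eventually_lt_const hδ)).exists
  refine ⟨replicaLayout d n I, params (1 - p) c a b,
    NetLayout.exists_isDropconnectFilter _ hp0 hp1.le, fun Ω _ P _ f hf => ?_⟩
  obtain ⟨h1, h2, h3⟩ := hsmall Ω P
    (fun ω => cubeSup ((replicaLayout d n I).reluNet (params (1 - p) c a b * f ω) - ζ))
    (fun ω => filterError (1 - p) c a b (f ω))
    (hf.measurable_comp fun φ =>
      cubeSup ((replicaLayout d n I).reluNet (params (1 - p) c a b * φ) - ζ))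
    (hf.measurable_comp _) (fun ω => cubeSup_nonneg _) (fun ω => filterError_nonneg hπ c a b _)
    (fun ω => filterError_le hn hπ (by linarith) c a b (hf.mem_Icc ω))
    (by
      filter_upwards [hf.ae_bias_one] with ω hω
      exact cubeSup_sub_le hπ hζ (hf.mem_Icc ω) hω)
    ((integral_filterError_le hn hp1 hf c a b).trans_lt hnδ)
  refine ⟨h1, h2, h3, ?_⟩
  have hE1 := hf.expectedFilter_inr
  have hE0 := hf.expectedFilter_inl hp1.le
  refine (cubeSup_sub_le hπ hζ ?_ hE1).trans_lt ?_
  · rintro (e | e)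
    · rw [hE0]
      constructor <;> linarith
    · simp [hE1]
  · rw [filterError_const hn hπ c a b hE0]
    linarith
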